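/- Let $M$ be a smooth manifold of dimension $4n+3$ ($n\ge 0$) with a smooth Riemannian metric $g$ and an almost $3$-contact metric structure $(\varphi_i,\xi_i,\eta_i,g)$, $i=1,2,3$: smooth $(1,1)$-tensor fields $\varphi_i$, vector fields $\xi_i$ and $1$-forms $\eta_i$ with $\varphi_i^2=-I+\eta_i\otimes\xi_i$, $\eta_i(\xi_i)=1$, $g(\varphi_iX,\varphi_iY)=g(X,Y)-\eta_i(X)\eta_i(Y)$ and, for every even permutation $(i,j,k)$ of $(1,2,3)$, $\varphi_k=\varphi_i\varphi_j-\eta_j\otimes\xi_i=-\varphi_j\varphi_i+\eta_i\otimes\xi_j$, $\xi_k=\varphi_i\xi_j=-\varphi_j\xi_i$, $\eta_k=\eta_i\circ\varphi_j=-\eta_j\circ\varphi_i$. Put $\Phi_i(X,Y)=g(X,\varphi_iY)$, $\mathcal H=\bigcap_i\ker\eta_i$, and $$N_{\varphi_i}(X,Y)=[\varphi_iX,\varphi_iY]+\varphi_i^2[X,Y]-\varphi_i[\varphi_iX,Y]-\varphi_i[X,\varphi_iY]+d\eta_i(X,Y)\xi_i ,$$ $N_{\varphi_i}(X,Y,Z)=g(N_{\varphi_i}(X,Y),Z)$,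 and, for $X,Y\in\Gamma(\mathcal H)$, $$A_{ij}(X,Y)=g((\mathcal L_{\xi_j}\varphi_i)X,Y)+d\eta_j(X,\varphi_iY)+d\eta_j(\varphi_iX,Y).$$ Here $d\eta(X,Y)=X(\eta(Y))-Y(\eta(X))-\eta([X,Y])$ and $(\eta\wedge\theta)(X,Y)=\eta(X)\theta(Y)-\theta(X)\eta(Y)$; the exterior derivative of $2$-forms is likewise taken without numerical factor. A function $\beta\in C^\infty(M)$ is called a *Reeb Killing function* if $A_{ii}(X,Y)=0$ and $A_{ij}(X,Y)=-A_{ji}(X,Y)=\beta\,\Phi_k(X,Y)$ for all $X,Y\in\Gamma(\mathcal H)$ and all even permutations $(i,j,k)$ of $(1,2,3)$; $\delta\in C^\infty(M)$ is called a *Reeb commutator function* if $\eta_k([\xi_i,\xi_j])=2\delta\epsilon_{ijk}$ for all $i,j,k$. The structure is called *canonical* if (1) each $N_{\varphi_i}$ is totally skew-symmetric on $\mathcal H$, i.e. $N_{\varphi_i}(X,Y,Z)$ is a $3$-form on $\mathcal H$; (2) each $\xi_i$ is a Killing vector field; (3) $N_{\varphi_i}(X,Y,Z)-d\Phi_i(\varphi_iX,\varphi_iY,\varphi_iZ)=N_{\varphi_j}(X,Y,Z)-d\Phi_j(\varphi_jX,\varphi_jY,\varphi_jZ)$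 for all $X,Y,Z\in\Gamma(\mathcal H)$ and all $i,j$; (4) it admits a Reeb Killing function. Suppose that the structure is $3$-$(\alpha,\delta)$-Sasaki, i.e. that for real constants $\alpha\neq0$ and $\delta$, $$d\eta_i=2\alpha\Phi_i+2(\alpha-\delta)\,\eta_j\wedge\eta_k\qquad\text{for every even permutation }(i,j,k)\text{ of }(1,2,3).$$ Then it is canonical (in particular each $\xi_i$ is Killing), and the constant function $\beta=2(\delta-2\alpha)$ is a Reeb Killing function. Moreover the constant $\delta$ is a Reeb commutator function and, for every vector field $X$ and every even permutation $(i,j,k)$ of $(1,2,3)$, with $\nabla^g$ the Levi-Civita connection, $$\nabla^g_X\xi_i=-\alpha\varphi_iX-(\alpha-\delta)\,[\eta_k(X)\xi_j-\eta_j(X)\xi_k],$$ $$\mathcal L_{\xi_i}\varphi_i=0,\qquad \mathcal L_{\xi_i}\varphi_j=-\mathcal L_{\xi_j}\varphi_i=2\delta\varphi_k .$$ -/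

import Mathlib

open Bundle
open scoped Manifold ContDiff

noncomputable section

namespace ThreeContact

section Calculus

variable {m : ℕ} {M : Type*} [TopologicalSpace M] [ChartedSpace (EuclideanSpace ℝ (Fin m)) M]

/-- Not necessarily smooth vector fields on the `m`-dimensional manifold `M`. -/
abbrev VField (m : ℕ) (M : Type*) [TopologicalSpace M]
    [ChartedSpace (EuclideanSpace ℝ (Fin m)) M] : Type _ :=
  (x : M) → TangentSpace (𝓡 m) x

/-- Not necessarily smooth `1`-forms. -/
abbrev OneForm (m : ℕ) (M : Type*) [TopologicalSpace M]
    [ChartedSpace (EuclideanSpace ℝ (Fin m)) M] : Type _ :=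
  (x : M) → TangentSpace (𝓡 m) x →L[ℝ] ℝ

/-- Not necessarily smooth `(1,1)`-tensor fields. -/
abbrev EndField (m : ℕ) (M : Type*) [TopologicalSpace M]
    [ChartedSpace (EuclideanSpace ℝ (Fin m)) M] : Type _ :=
  (x : M) → TangentSpace (𝓡 m) x →L[ℝ] TangentSpace (𝓡 m) x

/-- `X` is a smooth vector field. -/
def SmoothVField [IsManifold (𝓡 m) ∞ M] (X : VField m M) : Prop :=
  ContMDiff (𝓡 m) (𝓡 m).tangent ∞
    (fun x ↦ (TotalSpace.mk' (EuclideanSpace ℝ (Fin m)) x (X x) : TangentBundle (𝓡 m) M))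

/-- `f` is a smooth real function. -/
def SmoothFun (m : ℕ) {M : Type*} [TopologicalSpace M]
    [ChartedSpace (EuclideanSpace ℝ (Fin m)) M] (f : M → ℝ) : Prop :=
  ContMDiff (𝓡 m) 𝓘(ℝ, ℝ) ∞ f

/-- The derivative `X f` of the function `f` along the vector field `X`. -/
def dirDeriv (X : VField m M) (f : M → ℝ) (x : M) : ℝ :=
  mvfderiv (𝓡 m) f x (X x)

/-- The Lie bracket `[X, Y]`. -/
abbrev bracket (X Y : VField m M) : VField m M :=
  VectorField.mlieBracket (𝓡 m) X Y

/-- The vector field `φ X`. -/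
abbrev appEnd (φ : EndField m M) (X : VField m M) : VField m M := fun x ↦ φ x (X x)

/-- The function `η(X)`. -/
abbrev appForm (η : OneForm m M) (X : VField m M) : M → ℝ := fun x ↦ η x (X x)

/-- The exterior derivative of a `1`-form,
`dη(X, Y) = X(η(Y)) - Y(η(X)) - η([X, Y])`. -/
def dOne (η : OneForm m M) (X Y : VField m M) (x : M) : ℝ :=
  dirDeriv X (appForm η Y) x - dirDeriv Y (appForm η X) x - appForm η (bracket X Y) x

/-- The wedge product of two `1`-forms, `(η ∧ θ)(X, Y) = η(X) θ(Y) - θ(X) η(Y)`. -/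
def wedge (η θ : OneForm m M) (X Y : VField m M) (x : M) : ℝ :=
  appForm η X x * appForm θ Y x - appForm θ X x * appForm η Y x

/-- The exterior derivative of a `2`-form, given as a function of pairs of vector fields. -/
def dTwo (Φ : VField m M → VField m M → M → ℝ) (X Y Z : VField m M) (x : M) : ℝ :=
  dirDeriv X (Φ Y Z) x + dirDeriv Y (Φ Z X) x + dirDeriv Z (Φ X Y) x
    - Φ (bracket X Y) Z x - Φ (bracket Y Z) X x - Φ (bracket Z X) Y x

/-- The Lie derivative of a `(1,1)`-tensor field,
`(L_ξ φ) X = [ξ, φ X] - φ [ξ, X]`. -/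
def lieEnd (ξ : VField m M) (φ : EndField m M) (X : VField m M) : VField m M :=
  bracket ξ (appEnd φ X) - appEnd φ (bracket ξ X)

/-- The Nijenhuis tensor `N_φ = [φ, φ] + dη ⊗ ξ` of an almost contact structure. -/
def nijenhuis (φ : EndField m M) (ξ : VField m M) (η : OneForm m M) (X Y : VField m M) :
    VField m M := fun x ↦
  bracket (appEnd φ X) (appEnd φ Y) x + φ x (φ x (bracket X Y x))
    - φ x (bracket (appEnd φ X) Y x) - φ x (bracket X (appEnd φ Y) x)
    + dOne η X Y x • ξ x

section Metric

variable [RiemannianBundle (fun x : M ↦ TangentSpace (𝓡 m) x)]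

/-- The function `g(X, Y)`. -/
abbrev metric (X Y : VField m M) : M → ℝ := fun x ↦ inner ℝ (X x) (Y x)

/-- The Lie derivative of the Riemannian metric,
`(L_ξ g)(X, Y) = ξ(g(X, Y)) - g([ξ, X], Y) - g(X, [ξ, Y])`. -/
def lieMetric (ξ X Y : VField m M) (x : M) : ℝ :=
  dirDeriv ξ (metric X Y) x - metric (bracket ξ X) Y x - metric X (bracket ξ Y) x

/-- `ξ` is a Killing vector field: `L_ξ g = 0`. -/
def IsKilling [IsManifold (𝓡 m) ∞ M] (ξ : VField m M) : Prop :=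
  SmoothVField ξ ∧
    ∀ X Y : VField m M, SmoothVField X → SmoothVField Y → ∀ x, lieMetric ξ X Y x = 0

/-- `D` is the Levi-Civita connection of the smooth Riemannian metric: it is torsion free and
metric. -/
def IsLeviCivita [IsManifold (𝓡 m) ∞ M]
    [IsContMDiffRiemannianBundle (𝓡 m) ∞ (EuclideanSpace ℝ (Fin m))
      (fun x : M ↦ TangentSpace (𝓡 m) x)]
    (D : CovariantDerivative (𝓡 m) (EuclideanSpace ℝ (Fin m))
      (fun x : M ↦ TangentSpace (𝓡 m) x)) : Prop :=
  haveI : IsContMDiffRiemannianBundle (𝓡 m) 1 (EuclideanSpace ℝ (Fin m))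
      (fun x : M ↦ TangentSpace (𝓡 m) x) :=
    IsContMDiffRiemannianBundle.of_le (n := ∞) (mod_cast le_top)
  D.torsion = 0 ∧ D.IsMetricCompatible

end Metric

end Calculus

/-- The totally skew-symmetric symbol `ε_{ijk}` on three indices. -/
def eps (i j k : Fin 3) : ℝ :=
  if j = i + 1 ∧ k = i + 2 then 1 else if j = i + 2 ∧ k = i + 1 then -1 else 0

/-- An almost `3`-contact metric structure on the Riemannian manifold `M` of dimension `4n + 3`.
The index set is `Fin 3`, with addition modulo `3`, so that the even permutations `(i, j, k)` of
the three indices are exactly the triples `(i, i + 1, i + 2)`. The Riemannian metric `g` is the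
`RiemannianBundle` structure on the tangent bundle; its smoothness is the separate assumption
`IsContMDiffRiemannianBundle`. -/
structure AlmostThreeContactMetric (n : ℕ) (M : Type*) [TopologicalSpace M]
    [ChartedSpace (EuclideanSpace ℝ (Fin (4 * n + 3))) M]
    [IsManifold (𝓡 (4 * n + 3)) ∞ M]
    [RiemannianBundle (fun x : M ↦ TangentSpace (𝓡 (4 * n + 3)) x)] where
  φ : Fin 3 → EndField (4 * n + 3) M
  ξ : Fin 3 → VField (4 * n + 3) M
  η : Fin 3 → OneForm (4 * n + 3) M
  smooth_φ : ∀ i, ContMDiff (𝓡 (4 * n + 3))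
    ((𝓡 (4 * n + 3)).prod 𝓘(ℝ, EuclideanSpace ℝ (Fin (4 * n + 3)) →L[ℝ]
      EuclideanSpace ℝ (Fin (4 * n + 3)))) ∞
    (fun x ↦ TotalSpace.mk' (E := fun y : M ↦
      TangentSpace (𝓡 (4 * n + 3)) y →L[ℝ] TangentSpace (𝓡 (4 * n + 3)) y)
      (EuclideanSpace ℝ (Fin (4 * n + 3)) →L[ℝ] EuclideanSpace ℝ (Fin (4 * n + 3))) x (φ i x))
  smooth_ξ : ∀ i, SmoothVField (ξ i)
  smooth_η : ∀ i, ContMDiff (𝓡 (4 * n + 3))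
    ((𝓡 (4 * n + 3)).prod 𝓘(ℝ, EuclideanSpace ℝ (Fin (4 * n + 3)) →L[ℝ] ℝ)) ∞
    (fun x ↦ TotalSpace.mk' (E := fun y : M ↦ TangentSpace (𝓡 (4 * n + 3)) y →L[ℝ] ℝ)
      (EuclideanSpace ℝ (Fin (4 * n + 3)) →L[ℝ] ℝ) x (η i x))
  φ_sq : ∀ i x v, φ i x (φ i x v) = -v + η i x v • ξ i x
  η_ξ : ∀ i x, η i x (ξ i x) = 1
  φ_mul : ∀ i x v,
    φ (i + 2) x v = φ i x (φ (i + 1) x v) - η (i + 1) x v • ξ i x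
  φ_mul' : ∀ i x v,
    φ (i + 2) x v = -φ (i + 1) x (φ i x v) + η i x v • ξ (i + 1) x
  φ_ξ : ∀ i x, ξ (i + 2) x = φ i x (ξ (i + 1) x)
  φ_ξ' : ∀ i x, ξ (i + 2) x = -φ (i + 1) x (ξ i x)
  η_φ : ∀ i x v, η (i + 2) x v = η i x (φ (i + 1) x v)
  η_φ' : ∀ i x v, η (i + 2) x v = -η (i + 1) x (φ i x v)
  compatible : ∀ i x (v w : TangentSpace (𝓡 (4 * n + 3)) x),
    inner ℝ (φ i x v) (φ i x w) = inner ℝ v w - η i x v * η i x w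

namespace AlmostThreeContactMetric

variable {n : ℕ} {M : Type*} [TopologicalSpace M]
  [ChartedSpace (EuclideanSpace ℝ (Fin (4 * n + 3))) M]
  [IsManifold (𝓡 (4 * n + 3)) ∞ M]
  [RiemannianBundle (fun x : M ↦ TangentSpace (𝓡 (4 * n + 3)) x)]
  (S : AlmostThreeContactMetric n M)

/-- The fundamental `2`-form `Φ_i(X, Y) = g(X, φ_i Y)`. -/
def fundForm (i : Fin 3) (X Y : VField (4 * n + 3) M) : M → ℝ :=
  metric X (appEnd (S.φ i) Y)

/-- `X` is a smooth section of the horizontal distribution `H = ker η_1 ∩ ker η_2 ∩ ker η_3`. -/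
def Horizontal (X : VField (4 * n + 3) M) : Prop :=
  SmoothVField X ∧ ∀ i x, S.η i x (X x) = 0

/-- The `(1,2)`-tensor field `N_{φ_i}`. -/
def N (i : Fin 3) (X Y : VField (4 * n + 3) M) : VField (4 * n + 3) M :=
  nijenhuis (S.φ i) (S.ξ i) (S.η i) X Y

/-- `N_{φ_i}(X, Y, Z) = g(N_{φ_i}(X, Y), Z)`. -/
def N₃ (i : Fin 3) (X Y Z : VField (4 * n + 3) M) : M → ℝ :=
  metric (S.N i X Y) Z

/-- The tensor field
`A_{ij}(X, Y) = g((L_{ξ_j} φ_i) X, Y) + dη_j(X, φ_i Y) + dη_j(φ_i X, Y)`. -/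
def A (i j : Fin 3) (X Y : VField (4 * n + 3) M) (x : M) : ℝ :=
  metric (lieEnd (S.ξ j) (S.φ i) X) Y x + dOne (S.η j) X (appEnd (S.φ i) Y) x
    + dOne (S.η j) (appEnd (S.φ i) X) Y x

/-- `δ` is a Reeb commutator function: it is smooth and `η_k([ξ_i, ξ_j]) = 2 δ ε_{ijk}`. -/
def IsReebCommutatorFunction (δ : M → ℝ) : Prop :=
  SmoothFun (4 * n + 3) δ ∧
    ∀ i j k x, S.η k x (bracket (S.ξ i) (S.ξ j) x) = 2 * δ x * eps i j k

/-- `β` is a Reeb Killing function: it is smooth and, for horizontal `X`, `Y` and even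
permutations `(i, j, k)`, `A_{ii}(X, Y) = 0` and `A_{ij}(X, Y) = -A_{ji}(X, Y) = β Φ_k(X, Y)`. -/
def IsReebKillingFunction (β : M → ℝ) : Prop :=
  SmoothFun (4 * n + 3) β ∧
    ∀ X Y, S.Horizontal X → S.Horizontal Y → ∀ i x,
      S.A i i X Y x = 0 ∧
      S.A i (i + 1) X Y x = β x * S.fundForm (i + 2) X Y x ∧
      -S.A (i + 1) i X Y x = β x * S.fundForm (i + 2) X Y x

/-- `N_{φ_i}` is skew-symmetric on `H`, that is, a `3`-form on `H`. -/
def NSkewOnHorizontal (i : Fin 3) : Prop :=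
  ∀ X Y Z, S.Horizontal X → S.Horizontal Y → S.Horizontal Z → ∀ x,
    S.N₃ i X Y Z x = -S.N₃ i Y X Z x ∧ S.N₃ i X Y Z x = -S.N₃ i X Z Y x

/-- Canonical almost `3`-contact metric manifolds. -/
structure IsCanonical : Prop where
  skew : ∀ i, S.NSkewOnHorizontal i
  killing : ∀ i, IsKilling (S.ξ i)
  twist : ∀ X Y Z, S.Horizontal X → S.Horizontal Y → S.Horizontal Z → ∀ i j x,
    S.N₃ i X Y Z x
        - dTwo (S.fundForm i) (appEnd (S.φ i) X) (appEnd (S.φ i) Y) (appEnd (S.φ i) Z) x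
      = S.N₃ j X Y Z x
        - dTwo (S.fundForm j) (appEnd (S.φ j) X) (appEnd (S.φ j) Y) (appEnd (S.φ j) Z) x
  reebKilling : ∃ β : M → ℝ, S.IsReebKillingFunction β

/-- `3`-`(α, δ)`-Sasaki manifolds: `α ≠ 0` and
`dη_i = 2 α Φ_i + 2 (α - δ) η_j ∧ η_k` for every even permutation `(i, j, k)`. -/
def IsThreeAlphaDeltaSasaki (α δ : ℝ) : Prop :=
  α ≠ 0 ∧
    ∀ X Y : VField (4 * n + 3) M, SmoothVField X → SmoothVField Y → ∀ i x,
      dOne (S.η i) X Y x = 2 * α * S.fundForm i X Y x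
        + 2 * (α - δ) * wedge (S.η (i + 1)) (S.η (i + 2)) X Y x

end AlmostThreeContactMetric

end ThreeContact

end

/-! Contracting the structure equation with ξ_i gives dη_i(ξ_i,·) = 0, dη_{i+1}(ξ_i,·) = 2δη_{i+2}
and dη_{i+2}(ξ_i,·) = -2δη_{i+1}. Since α ≠ 0, Cartan's formula (`dirDeriv_dOne`) turns this into
L_{ξ_i}Φ_i = 0, L_{ξ_i}Φ_{i+1} = 2δΦ_{i+2} and L_{ξ_i}Φ_{i+2} = -2δΦ_{i+1}.

The forms Φ_{i+1}, Φ_{i+2} and the η's determine φ_i without the metric, so L_{ξ_i}φ_i = 0 comes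
before any Killing property (`lieEnd_self`). The metric is recovered from Φ_i, φ_i and η_i, hence
ξ_i is Killing (`isKilling`). The remaining Lie derivatives, the Reeb Killing function and the
formula for ∇ξ_i follow algebraically, the last through 2g(∇_Xξ_i, Y) = dη_i(X,Y).

For the other canonical conditions, dΦ_i vanishes on H because Φ_i is dη_i/(2α) up to wedge terms
invisible there. As in Hitchin's lemma for hypersymplectic triples, this closedness forces N_{φ_i} =
0 on H (`inner_N_horizontal`), so skewness and condition (3) reduce to 0 = 0. -/

namespace ThreeContact

/-! ### Calculus of smooth fields, exterior derivatives and Killing fields. -/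

section Calculus

variable {m : ℕ} {M : Type*} [TopologicalSpace M] [ChartedSpace (EuclideanSpace ℝ (Fin m)) M]

section Functions

variable {f g : M → ℝ}

lemma SmoothFun.mdifferentiableAt (hf : SmoothFun m f) (x : M) :
    MDifferentiableAt (𝓡 m) 𝓘(ℝ, ℝ) f x :=
  (ContMDiff.contMDiffAt hf).mdifferentiableAt (by simp)

lemma SmoothFun.const (c : ℝ) : SmoothFun m (fun _ : M ↦ c) := contMDiff_const

lemma SmoothFun.neg (hf : SmoothFun m f) : SmoothFun m (fun x ↦ -f x) := ContMDiff.neg hf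

lemma SmoothFun.sub (hf : SmoothFun m f) (hg : SmoothFun m g) :
    SmoothFun m (fun x ↦ f x - g x) := ContMDiff.sub hf hg

lemma SmoothFun.mul (hf : SmoothFun m f) (hg : SmoothFun m g) :
    SmoothFun m (fun x ↦ f x * g x) := ContMDiff.mul hf hg

lemma dirDeriv_const (X : VField m M) (c : ℝ) (x : M) : dirDeriv X (fun _ ↦ c) x = 0 := by
  simp [dirDeriv, mvfderiv_const]

lemma dirDeriv_add (X : VField m M) (hf : SmoothFun m f) (hg : SmoothFun m g) (x : M) :
    dirDeriv X (fun y ↦ f y + g y) x = dirDeriv X f x + dirDeriv X g x := by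
  simp [dirDeriv, mvfderiv_fun_add (hf.mdifferentiableAt x) (hg.mdifferentiableAt x)]

lemma dirDeriv_neg (X : VField m M) (f : M → ℝ) (x : M) :
    dirDeriv X (fun y ↦ -f y) x = -dirDeriv X f x := by
  simp [dirDeriv, mvfderiv_fun_neg]

lemma dirDeriv_sub (X : VField m M) (hf : SmoothFun m f) (hg : SmoothFun m g) (x : M) :
    dirDeriv X (fun y ↦ f y - g y) x = dirDeriv X f x - dirDeriv X g x := by
  simp [dirDeriv, mvfderiv_fun_sub (hf.mdifferentiableAt x) (hg.mdifferentiableAt x)]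

lemma dirDeriv_mul (X : VField m M) (hf : SmoothFun m f) (hg : SmoothFun m g) (x : M) :
    dirDeriv X (fun y ↦ f y * g y) x = f x * dirDeriv X g x + g x * dirDeriv X f x := by
  simp [dirDeriv, mvfderiv_fun_mul (hf.mdifferentiableAt x) (hg.mdifferentiableAt x)]

lemma dirDeriv_const_mul (X : VField m M) (c : ℝ) (hf : SmoothFun m f) (x : M) :
    dirDeriv X (fun y ↦ c * f y) x = c * dirDeriv X f x := by
  rw [dirDeriv_mul X (SmoothFun.const c) hf, dirDeriv_const]; ring

end Functions

lemma bracket_swap (X Y : VField m M) (x : M) : bracket X Y x = -bracket Y X x :=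
  VectorField.mlieBracket_swap_apply

lemma dOne_swap (η : OneForm m M) (X Y : VField m M) (x : M) : dOne η X Y x = -dOne η Y X x := by
  simp only [dOne, appForm, bracket_swap X Y x, map_neg]
  ring

variable [IsManifold (𝓡 m) ∞ M] {X Y Z : VField m M} {f : M → ℝ}

lemma SmoothVField.mdifferentiableAt (hX : SmoothVField X) (x : M) :
    MDifferentiableAt (𝓡 m) (𝓡 m).tangent
      (fun x ↦ (TotalSpace.mk' (EuclideanSpace ℝ (Fin m)) x (X x) : TangentBundle (𝓡 m) M)) x :=
  (ContMDiff.contMDiffAt hX).mdifferentiableAt (by simp)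

lemma SmoothVField.sub (hX : SmoothVField X) (hY : SmoothVField Y) : SmoothVField (X - Y) :=
  ContMDiff.sub_section hX hY

lemma SmoothFun.smul (hf : SmoothFun m f) (hX : SmoothVField X) : SmoothVField (f • X) :=
  ContMDiff.smul_section hf hX

lemma SmoothVField.bracket (hX : SmoothVField X) (hY : SmoothVField Y) :
    SmoothVField (bracket X Y) := by
  have : IsManifold (𝓡 m) (((⊤ : ℕ∞) : WithTop ℕ∞) + 1) M :=
    inferInstanceAs (IsManifold (𝓡 m) ∞ M)
  have : IsManifold (𝓡 m) (minSmoothness ℝ 2) M :=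
    IsManifold.of_le (n := ∞) (by simpa using ENat.LEInfty.out)
  exact ContDiff.mlieBracket_vectorField (m := (⊤ : ℕ∞)) (n := (⊤ : ℕ∞)) hX hY (by simp)

lemma SmoothVField.appEnd {φ : EndField m M}
    (hφ : ContMDiff (𝓡 m) ((𝓡 m).prod 𝓘(ℝ, EuclideanSpace ℝ (Fin m) →L[ℝ]
      EuclideanSpace ℝ (Fin m))) ∞
      (fun x ↦ TotalSpace.mk' (E := fun y : M ↦
        TangentSpace (𝓡 m) y →L[ℝ] TangentSpace (𝓡 m) y)
        (EuclideanSpace ℝ (Fin m) →L[ℝ] EuclideanSpace ℝ (Fin m)) x (φ x)))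
    (hX : SmoothVField X) : SmoothVField (appEnd φ X) :=
  ContMDiff.clm_bundle_apply hφ hX

lemma SmoothVField.appForm {η : OneForm m M}
    (hη : ContMDiff (𝓡 m) ((𝓡 m).prod 𝓘(ℝ, EuclideanSpace ℝ (Fin m) →L[ℝ] ℝ)) ∞
      (fun x ↦ TotalSpace.mk' (E := fun y : M ↦ TangentSpace (𝓡 m) y →L[ℝ] ℝ)
        (EuclideanSpace ℝ (Fin m) →L[ℝ] ℝ) x (η x)))
    (hX : SmoothVField X) : SmoothFun m (appForm η X) := by
  have h : ContMDiff (𝓡 m) ((𝓡 m).prod 𝓘(ℝ, ℝ)) ∞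
      (fun x ↦ TotalSpace.mk' ℝ (E := Bundle.Trivial M ℝ) x (η x (X x))) :=
    ContMDiff.clm_bundle_apply (E₂ := Bundle.Trivial M ℝ) (F₂ := ℝ) hη hX
  intro x
  exact (contMDiffAt_section x).1 (h x)

lemma SmoothVField.dirDeriv (hX : SmoothVField X) (hf : SmoothFun m f) :
    SmoothFun m (dirDeriv X f) := by
  have h1 := (ContMDiff.contMDiff_tangentMap hf (m := ∞) (by simp)).comp hX
  exact (contMDiff_snd_tangentBundle_modelSpace ℝ 𝓘(ℝ, ℝ)).comp h1

lemma SmoothVField.metric [RiemannianBundle (fun x : M ↦ TangentSpace (𝓡 m) x)]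
    [IsContMDiffRiemannianBundle (𝓡 m) ∞ (EuclideanSpace ℝ (Fin m))
      (fun x : M ↦ TangentSpace (𝓡 m) x)]
    (hX : SmoothVField X) (hY : SmoothVField Y) : SmoothFun m (metric X Y) :=
  ContMDiff.inner_bundle hX hY

lemma bracket_smul_right (hf : SmoothFun m f) (hY : SmoothVField Y) (X : VField m M) (x : M) :
    bracket X (f • Y) x = dirDeriv X f x • Y x + f x • bracket X Y x :=
  VectorField.mlieBracket_smul_right (hf.mdifferentiableAt x) (hY.mdifferentiableAt x)

lemma bracket_add_right (hY : SmoothVField Y) (hZ : SmoothVField Z) (X : VField m M) (x : M) :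
    bracket X (Y + Z) x = bracket X Y x + bracket X Z x :=
  VectorField.mlieBracket_add_right (hY.mdifferentiableAt x) (hZ.mdifferentiableAt x)

lemma bracket_jacobi (hX : SmoothVField X) (hY : SmoothVField Y) (hZ : SmoothVField Z) (x : M) :
    bracket X (bracket Y Z) x = bracket (bracket X Y) Z x + bracket Y (bracket X Z) x := by
  have : IsManifold (𝓡 m) (minSmoothness ℝ 3) M :=
    IsManifold.of_le (n := ∞) (by simpa using ENat.LEInfty.out)
  have hle : minSmoothness ℝ 2 ≤ (∞ : WithTop ℕ∞) := by simpa using ENat.LEInfty.out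
  exact VectorField.leibniz_identity_mlieBracket_apply
    ((ContMDiff.contMDiffAt hX).of_le hle) ((ContMDiff.contMDiffAt hY).of_le hle)
    ((ContMDiff.contMDiffAt hZ).of_le hle)

/-- Every tangent vector extends to a smooth vector field. -/
lemma exists_smoothVField_eq [T2Space M] (x : M) (v : TangentSpace (𝓡 m) x) :
    ∃ X : VField m M, SmoothVField X ∧ X x = v := by
  obtain ⟨s, hs, hsmooth⟩ := FiberBundle.exists_contMDiffOn_extend (k := ∞) (𝓡 m)
    (EuclideanSpace ℝ (Fin m)) (V := fun y : M ↦ TangentSpace (𝓡 m) y) v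
  obtain ⟨u, hus, huo, hxu⟩ := mem_nhds_iff.1 hs
  -- A bump function supported where the local extension is smooth makes the product globally
  -- smooth; its value 1 at `x` preserves `v`.
  obtain ⟨ψ, -, hψ⟩ := (SmoothBumpFunction.nhds_basis_tsupport (I := 𝓡 m) x).mem_iff.1
    (huo.mem_nhds hxu)
  refine ⟨(ψ : M → ℝ) • FiberBundle.extend (EuclideanSpace ℝ (Fin m)) v, ?_, ?_⟩
  · exact ContMDiffOn.smul_section_of_tsupport ψ.contMDiff.contMDiffOn huo hψ (hsmooth.mono hus)
  · simp

/-- Follows from the Jacobi identity for X, Y, fZ: after expanding by the Leibniz rule and removing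
f times the identity for X, Y, Z, only the coefficients of Z(x) remain, and Z is chosen nonzero at
x. -/
lemma dirDeriv_bracket [T2Space M] (hX : SmoothVField X) (hY : SmoothVField Y)
    (hf : SmoothFun m f) (x : M) :
    dirDeriv (bracket X Y) f x = dirDeriv X (dirDeriv Y f) x - dirDeriv Y (dirDeriv X f) x := by
  rcases subsingleton_or_nontrivial (TangentSpace (𝓡 m) x) with hE | hE
  · have h (W : VField m M) (h : M → ℝ) : dirDeriv W h x = 0 := by
      rw [ThreeContact.dirDeriv, Subsingleton.elim (W x) 0, map_zero]
    simp only [h, sub_zero]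
  obtain ⟨v, hv⟩ := exists_ne (0 : TangentSpace (𝓡 m) x)
  obtain ⟨Z, hZ, rfl⟩ := exists_smoothVField_eq x v
  have step {V W : VField m M} (hV : SmoothVField V) (hW : SmoothVField W) :
      bracket V (bracket W (f • Z)) x = dirDeriv V (dirDeriv W f) x • Z x
        + dirDeriv W f x • bracket V Z x + dirDeriv V f x • bracket W Z x
        + f x • bracket V (bracket W Z) x := by
    have : bracket W (f • Z) = dirDeriv W f • Z + f • bracket W Z := by
      funext y
      exact bracket_smul_right hf hZ W y
    rw [this, bracket_add_right (SmoothFun.smul (hW.dirDeriv hf) hZ) (hf.smul (hW.bracket hZ)),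
      bracket_smul_right (hW.dirDeriv hf) hZ, bracket_smul_right hf (hW.bracket hZ)]
    abel
  have h := bracket_jacobi hX hY (hf.smul hZ) x
  rw [step hX hY, step hY hX, bracket_smul_right hf hZ, bracket_jacobi hX hY hZ] at h
  refine smul_left_injective ℝ hv ?_
  simp only [sub_smul]
  linear_combination (norm := module) -h

lemma bracket_neg_left (hX : SmoothVField X) (Y : VField m M) (x : M) :
    bracket (-X) Y x = -bracket X Y x := by
  have h := VectorField.mlieBracket_const_smul_left (I := 𝓡 m) (c := (-1 : ℝ)) (W := Y)
    (hX.mdifferentiableAt x)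
  rwa [neg_one_smul, neg_one_smul] at h

/-- The exterior derivative of a smooth `1`-form is closed. -/
lemma dTwo_dOne [T2Space M] {η : OneForm m M}
    (hη : ContMDiff (𝓡 m) ((𝓡 m).prod 𝓘(ℝ, EuclideanSpace ℝ (Fin m) →L[ℝ] ℝ)) ∞
      (fun x ↦ TotalSpace.mk' (E := fun y : M ↦ TangentSpace (𝓡 m) y →L[ℝ] ℝ)
        (EuclideanSpace ℝ (Fin m) →L[ℝ] ℝ) x (η x)))
    (hX : SmoothVField X) (hY : SmoothVField Y) (hZ : SmoothVField Z) (x : M) :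
    dTwo (dOne η) X Y Z x = 0 := by
  have hs {V : VField m M} (hV : SmoothVField V) := hV.appForm hη
  have key {U V W : VField m M} (hU : SmoothVField U) (hV : SmoothVField V)
      (hW : SmoothVField W) : dirDeriv U (dOne η V W) x =
        dirDeriv U (dirDeriv V (appForm η W)) x - dirDeriv U (dirDeriv W (appForm η V)) x
          - dirDeriv U (appForm η (bracket V W)) x := by
    have : dOne η V W = fun y ↦ (dirDeriv V (appForm η W) y - dirDeriv W (appForm η V) y)
        - appForm η (bracket V W) y := rfl
    rw [this, dirDeriv_sub _ ((hV.dirDeriv (hs hW)).sub (hW.dirDeriv (hs hV)))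
      (hs (hV.bracket hW)), dirDeriv_sub _ (hV.dirDeriv (hs hW)) (hW.dirDeriv (hs hV))]
  -- The second derivatives cancel against derivatives along brackets; what is left of d(dη) is η of
  -- the cyclic Jacobi sum.
  have hj : η x (bracket (bracket X Y) Z x) + η x (bracket (bracket Y Z) X x)
      + η x (bracket (bracket Z X) Y x) = 0 := by
    have h := bracket_jacobi hX hY hZ x
    rw [bracket_swap X (bracket Y Z)] at h
    have h2 : bracket Y (bracket X Z) x = bracket (bracket Z X) Y x := by
      have h3 : bracket X Z = -bracket Z X := VectorField.mlieBracket_swap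
      rw [bracket_swap Y, h3, bracket_neg_left (hZ.bracket hX), neg_neg]
    rw [h2] at h
    rw [← map_add, ← map_add, add_right_comm, ← h, neg_add_cancel, map_zero]
  simp only [dTwo, key hX hY hZ, key hY hZ hX, key hZ hX hY]
  simp only [dOne, dirDeriv_bracket hX hY (hs hZ), dirDeriv_bracket hY hZ (hs hX),
    dirDeriv_bracket hZ hX (hs hY)]
  simp only [appForm] at hj ⊢
  linear_combination hj

lemma dOne_neg_left (η : OneForm m M) (hX : SmoothVField X) (Y : VField m M) (x : M) :
    dOne η (-X) Y x = -dOne η X Y x := by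
  have h1 : appForm η (-X) = fun y ↦ -appForm η X y := by
    funext y
    simp [appForm]
  have h2 : dirDeriv (-X) (appForm η Y) x = -dirDeriv X (appForm η Y) x := by
    simp [dirDeriv]
  simp only [dOne, h1, h2, dirDeriv_neg, bracket_neg_left hX, appForm, map_neg]
  ring

/-- Cartan's formula: if `dη(ξ, ·) = c θ` with `c` constant, then `L_ξ dη = c dθ`. -/
lemma dirDeriv_dOne [T2Space M] {η θ : OneForm m M} {ξ : VField m M} {c : ℝ}
    (hη : ContMDiff (𝓡 m) ((𝓡 m).prod 𝓘(ℝ, EuclideanSpace ℝ (Fin m) →L[ℝ] ℝ)) ∞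
      (fun x ↦ TotalSpace.mk' (E := fun y : M ↦ TangentSpace (𝓡 m) y →L[ℝ] ℝ)
        (EuclideanSpace ℝ (Fin m) →L[ℝ] ℝ) x (η x)))
    (hθ : ContMDiff (𝓡 m) ((𝓡 m).prod 𝓘(ℝ, EuclideanSpace ℝ (Fin m) →L[ℝ] ℝ)) ∞
      (fun x ↦ TotalSpace.mk' (E := fun y : M ↦ TangentSpace (𝓡 m) y →L[ℝ] ℝ)
        (EuclideanSpace ℝ (Fin m) →L[ℝ] ℝ) x (θ x)))
    (hξ : SmoothVField ξ)
    (h : ∀ X : VField m M, SmoothVField X → ∀ x, dOne η ξ X x = c * θ x (X x))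
    (hX : SmoothVField X) (hY : SmoothVField Y) (x : M) :
    dirDeriv ξ (dOne η X Y) x = dOne η (bracket ξ X) Y x + dOne η X (bracket ξ Y) x
      + c * dOne θ X Y x := by
  have hd := dTwo_dOne hη hξ hX hY x
  have h1 : dOne η ξ X = fun y ↦ c * appForm θ X y := funext (h X hX)
  have h2 : dOne η Y ξ = fun y ↦ -(c * appForm θ Y y) := by
    funext y
    rw [dOne_swap, h Y hY]
  have h3 : bracket Y ξ = -bracket ξ Y := VectorField.mlieBracket_swap
  rw [dTwo, h1, h2, h3, dirDeriv_neg, dirDeriv_const_mul _ _ (hX.appForm hθ),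
    dirDeriv_const_mul _ _ (hY.appForm hθ), dOne_neg_left η (hξ.bracket hY),
    dOne_swap η (bracket X Y), dOne_swap η (bracket ξ Y), h _ (hX.bracket hY)] at hd
  simp only [dOne, appForm] at hd ⊢
  linear_combination hd

/-- For a Killing field `ξ` dual to `η`, the Levi-Civita connection satisfies
`2 g(∇_X ξ, Y) = dη(X, Y)`. -/
lemma IsLeviCivita.two_mul_inner_killing
    [RiemannianBundle (fun x : M ↦ TangentSpace (𝓡 m) x)]
    [IsContMDiffRiemannianBundle (𝓡 m) ∞ (EuclideanSpace ℝ (Fin m))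
      (fun x : M ↦ TangentSpace (𝓡 m) x)]
    {D : CovariantDerivative (𝓡 m) (EuclideanSpace ℝ (Fin m))
      (fun x : M ↦ TangentSpace (𝓡 m) x)} (hD : IsLeviCivita D)
    {ξ : VField m M} (hξ : IsKilling ξ) {η : OneForm m M}
    (hη : ∀ x (v : TangentSpace (𝓡 m) x), inner ℝ (ξ x) v = η x v)
    (hX : SmoothVField X) (hY : SmoothVField Y) (x : M) :
    2 * inner ℝ (D ξ x (X x)) (Y x) = dOne η X Y x := by
  have : IsContMDiffRiemannianBundle (𝓡 m) 1 (EuclideanSpace ℝ (Fin m))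
      (fun x : M ↦ TangentSpace (𝓡 m) x) :=
    IsContMDiffRiemannianBundle.of_le (n := ∞) (mod_cast le_top)
  obtain ⟨htor, hmet⟩ := hD
  rw [CovariantDerivative.torsion_eq_zero_iff] at htor
  have hm {U V W : VField m M} (hV : SmoothVField V) (hW : SmoothVField W) :
      dirDeriv U (metric V W) x = inner ℝ (D V x (U x)) (W x) + inner ℝ (V x) (D W x (U x)) :=
    hmet.mvfderiv_inner_eq U (hV.mdifferentiableAt x) (hW.mdifferentiableAt x)
  have ht {U V : VField m M} (hU : SmoothVField U) (hV : SmoothVField V) :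
      bracket U V x = D V x (U x) - D U x (V x) :=
    (htor (hU.mdifferentiableAt x) (hV.mdifferentiableAt x)).symm
  have hηm (V : VField m M) : appForm η V = metric ξ V := funext fun y ↦ (hη y (V y)).symm
  have hk := hξ.2 X Y hX hY x
  simp only [lieMetric, hm hX hY, metric, ht hξ.1 hX, ht hξ.1 hY, inner_sub_left,
    inner_sub_right] at hk
  rw [dOne, hηm, hηm, hηm, hm hξ.1 hY, hm hξ.1 hX]
  simp only [metric, ht hX hY, inner_sub_right]
  rw [real_inner_comm (X x) (D ξ x (Y x))] at *
  linear_combination hk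

end Calculus

/-! ### Cyclic index arithmetic. -/

lemma fin_three_cases (i l : Fin 3) : l = i ∨ l = i + 1 ∨ l = i + 2 := by
  revert i l; decide

lemma fin_three_add_one_one (i : Fin 3) : i + 1 + 1 = i + 2 := by revert i; decide

lemma fin_three_add_one_two (i : Fin 3) : i + 1 + 2 = i := by revert i; decide

lemma fin_three_add_two_one (i : Fin 3) : i + 2 + 1 = i := by revert i; decide

lemma fin_three_add_two_two (i : Fin 3) : i + 2 + 2 = i + 1 := by revert i; decide

lemma eps_self_right (i j : Fin 3) : eps i j i = 0 := by
  fin_cases i <;> simp [eps]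

lemma eps_add_one_right (i j : Fin 3) : eps i j (i + 1) = -if i + 2 = j then 1 else 0 := by
  fin_cases i <;> fin_cases j <;> simp [eps]

lemma eps_add_two_right (i j : Fin 3) : eps i j (i + 2) = if i + 1 = j then 1 else 0 := by
  fin_cases i <;> fin_cases j <;> simp [eps]

namespace AlmostThreeContactMetric

variable {n : ℕ} {M : Type*} [TopologicalSpace M]
  [ChartedSpace (EuclideanSpace ℝ (Fin (4 * n + 3))) M]
  [IsManifold (𝓡 (4 * n + 3)) ∞ M]
  [RiemannianBundle (fun x : M ↦ TangentSpace (𝓡 (4 * n + 3)) x)]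
  (S : AlmostThreeContactMetric n M)

/-! ### Pointwise algebra of the three structures. -/

section Algebra

variable (i : Fin 3) (x : M) (v w : TangentSpace (𝓡 (4 * n + 3)) x)

/-- From φ²ξ = 0, the identity for φ² at φξ gives φξ = cξ with c = η(φξ); applying φ again yields c²
= 0. -/
lemma φ_ξ_self : S.φ i x (S.ξ i x) = 0 := by
  have h1 : S.φ i x (S.φ i x (S.ξ i x)) = 0 := by rw [S.φ_sq, S.η_ξ, one_smul, neg_add_cancel]
  have h2 : S.φ i x (S.ξ i x) = S.η i x (S.φ i x (S.ξ i x)) • S.ξ i x := by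
    have h := S.φ_sq i x (S.φ i x (S.ξ i x))
    rw [h1, map_zero] at h
    exact (neg_add_eq_zero.1 h.symm)
  set c := S.η i x (S.φ i x (S.ξ i x))
  have h3 : c * c = 0 := by
    have h := congrArg (S.η i x) h1
    rw [h2, map_smul, h2, smul_smul, map_smul, S.η_ξ, map_zero] at h
    simpa using h
  rw [h2, mul_self_eq_zero.1 h3, zero_smul]

/-- Compare the two ways of computing φ³v. -/
lemma η_φ_self : S.η i x (S.φ i x v) = 0 := by
  have h := S.φ_sq i x (S.φ i x v)
  rw [S.φ_sq i x v, map_add, map_neg, map_smul, S.φ_ξ_self, smul_zero, add_zero] at h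
  have h2 := congrArg (S.η i x) h
  rw [map_add, map_smul, S.η_ξ] at h2
  simpa using h2

lemma inner_ξ : inner ℝ (S.ξ i x) v = S.η i x v := by
  have h := S.compatible i x (S.ξ i x) v
  rw [S.φ_ξ_self, inner_zero_left, S.η_ξ] at h
  linarith

/-- Compatibility applied to v and φw; the η-terms die because η∘φ = 0. -/
lemma inner_φ_left : inner ℝ (S.φ i x v) w = -inner ℝ v (S.φ i x w) := by
  have h := S.compatible i x v (S.φ i x w)
  rw [S.φ_sq, inner_add_right, inner_neg_right, inner_smul_right, S.η_φ_self,
    real_inner_comm (S.ξ i x), S.inner_ξ, S.η_φ_self] at h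
  linarith

lemma η_φ_zero_one : S.η i x (S.φ (i + 1) x v) = S.η (i + 2) x v := (S.η_φ i x v).symm

lemma η_φ_zero_two : S.η i x (S.φ (i + 2) x v) = -S.η (i + 1) x v := by
  have h := S.η_φ' (i + 2) x v
  rw [fin_three_add_two_two, fin_three_add_two_one] at h
  rw [h, neg_neg]

lemma η_φ_one_zero : S.η (i + 1) x (S.φ i x v) = -S.η (i + 2) x v := by
  rw [S.η_φ', neg_neg]

lemma η_φ_two_zero : S.η (i + 2) x (S.φ i x v) = S.η (i + 1) x v := by
  have h := S.η_φ (i + 2) x v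
  rw [fin_three_add_two_two, fin_three_add_two_one] at h
  exact h.symm

lemma φ_φ_zero_one :
    S.φ i x (S.φ (i + 1) x v) = S.φ (i + 2) x v + S.η (i + 1) x v • S.ξ i x := by
  rw [S.φ_mul, sub_add_cancel]

lemma φ_φ_one_zero :
    S.φ (i + 1) x (S.φ i x v) = -S.φ (i + 2) x v + S.η i x v • S.ξ (i + 1) x := by
  rw [S.φ_mul' i x v]; abel

lemma φ_φ_zero_two :
    S.φ i x (S.φ (i + 2) x v) = -S.φ (i + 1) x v + S.η (i + 2) x v • S.ξ i x := by
  have h := S.φ_φ_one_zero (i + 2) x v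
  rwa [fin_three_add_two_two, fin_three_add_two_one] at h

lemma φ_φ_two_zero :
    S.φ (i + 2) x (S.φ i x v) = S.φ (i + 1) x v + S.η i x v • S.ξ (i + 2) x := by
  have h := S.φ_φ_zero_one (i + 2) x v
  rwa [fin_three_add_two_two, fin_three_add_two_one] at h

lemma η_ξ_one : S.η (i + 1) x (S.ξ i x) = 0 := by
  rw [← S.η_φ_two_zero, S.φ_ξ_self, map_zero]

lemma η_ξ_two : S.η (i + 2) x (S.ξ i x) = 0 := by
  rw [← neg_inj, ← S.η_φ_one_zero, S.φ_ξ_self, map_zero, neg_zero]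

lemma η_ξ_apply (i j : Fin 3) (x : M) : S.η i x (S.ξ j x) = if i = j then 1 else 0 := by
  rcases fin_three_cases j i with rfl | rfl | rfl
  · simp [S.η_ξ]
  · simp [S.η_ξ_one]
  · simp [S.η_ξ_two]

lemma eq_zero_of_φ_eq_zero {v : TangentSpace (𝓡 (4 * n + 3)) x} (h : S.φ i x v = 0)
    (h' : S.η i x v = 0) : v = 0 := by
  have h2 := S.φ_sq i x v
  rw [h, h', map_zero, zero_smul, add_zero] at h2
  exact neg_eq_zero.1 h2.symm

end Algebra

/-! ### Smoothness, and stability of H under the φ's. -/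

section Smooth

variable {S} {X Y Z : VField (4 * n + 3) M}

lemma smooth_appEnd (S : AlmostThreeContactMetric n M) (i : Fin 3) (hX : SmoothVField X) :
    SmoothVField (appEnd (S.φ i) X) := hX.appEnd (S.smooth_φ i)

lemma smooth_appForm (S : AlmostThreeContactMetric n M) (i : Fin 3) (hX : SmoothVField X) :
    SmoothFun (4 * n + 3) (appForm (S.η i) X) := hX.appForm (S.smooth_η i)

lemma Horizontal.appEnd (hX : S.Horizontal X) (l : Fin 3) : S.Horizontal (appEnd (S.φ l) X) := by
  refine ⟨S.smooth_appEnd l hX.1, fun i x ↦ ?_⟩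
  rcases fin_three_cases l i with rfl | rfl | rfl
  · exact S.η_φ_self _ x _
  · exact (S.η_φ_one_zero l x _).trans (by rw [hX.2, neg_zero])
  · exact (S.η_φ_two_zero l x _).trans (hX.2 _ x)

lemma dirDeriv_wedge (hX : SmoothVField X) (hY : SmoothVField Y) (ξ : VField (4 * n + 3) M)
    (i j : Fin 3) (x : M) :
    dirDeriv ξ (wedge (S.η i) (S.η j) X Y) x =
      dirDeriv ξ (appForm (S.η i) X) x * S.η j x (Y x)
        + S.η i x (X x) * dirDeriv ξ (appForm (S.η j) Y) x
        - dirDeriv ξ (appForm (S.η j) X) x * S.η i x (Y x)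
        - S.η j x (X x) * dirDeriv ξ (appForm (S.η i) Y) x := by
  have h : wedge (S.η i) (S.η j) X Y = fun y ↦ appForm (S.η i) X y * appForm (S.η j) Y y
      - appForm (S.η j) X y * appForm (S.η i) Y y := rfl
  have hη {V : VField (4 * n + 3) M} (hV : SmoothVField V) (l : Fin 3) := S.smooth_appForm l hV
  rw [h, dirDeriv_sub _ ((hη hX i).mul (hη hY j)) ((hη hX j).mul (hη hY i)),
    dirDeriv_mul _ (hη hX i) (hη hY j), dirDeriv_mul _ (hη hX j) (hη hY i)]
  simp only [appForm]
  ring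

end Smooth

/-! ### Contractions of the structure equation with Reeb fields. -/

section Sasaki

variable {S} {α δ : ℝ} {X Y Z : VField (4 * n + 3) M}

lemma IsThreeAlphaDeltaSasaki.dOne_ξ_self (hS : S.IsThreeAlphaDeltaSasaki α δ) (i : Fin 3)
    (hX : SmoothVField X) (x : M) : dOne (S.η i) (S.ξ i) X x = 0 := by
  rw [hS.2 _ _ (S.smooth_ξ i) hX]
  simp [fundForm, metric, appEnd, wedge, appForm, S.inner_ξ, S.η_φ_self, S.η_ξ_one, S.η_ξ_two]

/-- The Φ-term contributes 2α and the wedge term -2(α - δ), so α drops out. -/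
lemma IsThreeAlphaDeltaSasaki.dOne_ξ_one (hS : S.IsThreeAlphaDeltaSasaki α δ) (i : Fin 3)
    (hX : SmoothVField X) (x : M) :
    dOne (S.η (i + 1)) (S.ξ i) X x = 2 * δ * S.η (i + 2) x (X x) := by
  rw [hS.2 _ _ (S.smooth_ξ i) hX, fin_three_add_one_one, fin_three_add_one_two]
  simp only [fundForm, metric, appEnd, wedge, appForm, S.inner_ξ, S.η_φ_zero_one, S.η_ξ,
    S.η_ξ_two]
  ring

lemma IsThreeAlphaDeltaSasaki.dOne_ξ_two (hS : S.IsThreeAlphaDeltaSasaki α δ) (i : Fin 3)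
    (hX : SmoothVField X) (x : M) :
    dOne (S.η (i + 2)) (S.ξ i) X x = -(2 * δ) * S.η (i + 1) x (X x) := by
  rw [hS.2 _ _ (S.smooth_ξ i) hX, fin_three_add_two_one, fin_three_add_two_two]
  simp only [fundForm, metric, appEnd, wedge, appForm, S.inner_ξ, S.η_φ_zero_two, S.η_ξ,
    S.η_ξ_one]
  ring

/-- This is L_{ξ_i}η_l = ι_{ξ_i}dη_l, valid because η_l(ξ_i) is constant. -/
lemma dirDeriv_appForm_ξ (S : AlmostThreeContactMetric n M) (i l : Fin 3)
    (X : VField (4 * n + 3) M) (x : M) :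
    dirDeriv (S.ξ i) (appForm (S.η l) X) x =
      S.η l x (bracket (S.ξ i) X x) + dOne (S.η l) (S.ξ i) X x := by
  have h : appForm (S.η l) (S.ξ i) = fun y ↦ if l = i then 1 else 0 :=
    funext (S.η_ξ_apply l i)
  rw [dOne, h, dirDeriv_const]
  simp only [appForm]
  ring

lemma IsThreeAlphaDeltaSasaki.isReebCommutatorFunction (hS : S.IsThreeAlphaDeltaSasaki α δ) :
    S.IsReebCommutatorFunction (fun _ ↦ δ) := by
  refine ⟨SmoothFun.const _, fun i j k x ↦ ?_⟩
  have hc (l : Fin 3) : S.η l x (bracket (S.ξ i) (S.ξ j) x) = -dOne (S.η l) (S.ξ i) (S.ξ j) x := by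
    have h : appForm (S.η l) (S.ξ j) = fun y ↦ if l = j then 1 else 0 :=
      funext (S.η_ξ_apply l j)
    have h2 := S.dirDeriv_appForm_ξ i l (S.ξ j) x
    rw [h, dirDeriv_const] at h2
    linarith
  have hj := S.smooth_ξ j
  rw [hc]
  rcases fin_three_cases i k with rfl | rfl | rfl
  · rw [hS.dOne_ξ_self _ hj, eps_self_right]
    ring
  · rw [hS.dOne_ξ_one i hj, eps_add_one_right, S.η_ξ_apply]
    ring
  · rw [hS.dOne_ξ_two i hj, eps_add_two_right, S.η_ξ_apply]
    ring

variable [IsContMDiffRiemannianBundle (𝓡 (4 * n + 3)) ∞ (EuclideanSpace ℝ (Fin (4 * n + 3)))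
    (fun x : M ↦ TangentSpace (𝓡 (4 * n + 3)) x)]

lemma smooth_fundForm (S : AlmostThreeContactMetric n M) (i : Fin 3) (hX : SmoothVField X)
    (hY : SmoothVField Y) : SmoothFun (4 * n + 3) (S.fundForm i X Y) :=
  hX.metric (S.smooth_appEnd i hY)

lemma IsThreeAlphaDeltaSasaki.dirDeriv_dOne_eq (hS : S.IsThreeAlphaDeltaSasaki α δ) (l : Fin 3)
    (ξ : VField (4 * n + 3) M) (hX : SmoothVField X) (hY : SmoothVField Y) (x : M) :
    dirDeriv ξ (dOne (S.η l) X Y) x = 2 * α * dirDeriv ξ (S.fundForm l X Y) x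
      + 2 * (α - δ) * dirDeriv ξ (wedge (S.η (l + 1)) (S.η (l + 2)) X Y) x := by
  have h : dOne (S.η l) X Y = fun y ↦ 2 * α * S.fundForm l X Y y
      + 2 * (α - δ) * wedge (S.η (l + 1)) (S.η (l + 2)) X Y y := funext (hS.2 X Y hX hY l)
  have hΦ := S.smooth_fundForm l hX hY
  have hw : SmoothFun (4 * n + 3) (wedge (S.η (l + 1)) (S.η (l + 2)) X Y) :=
    ((S.smooth_appForm _ hX).mul (S.smooth_appForm _ hY)).sub
      ((S.smooth_appForm _ hX).mul (S.smooth_appForm _ hY))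
  rw [h, dirDeriv_add _ ((SmoothFun.const _).mul hΦ) ((SmoothFun.const _).mul hw),
    dirDeriv_const_mul _ _ hΦ, dirDeriv_const_mul _ _ hw]

/-! ### Lie derivatives along the Reeb fields and the Killing property. -/

variable [T2Space M]

/-- Here L_{ξ_i}dη_i = 0, and η_{i+1} ∧ η_{i+2} is also invariant: ξ_i rotates the two factors into
each other. Dividing by 2α leaves Φ_i. -/
lemma IsThreeAlphaDeltaSasaki.dirDeriv_fundForm_self (hS : S.IsThreeAlphaDeltaSasaki α δ)
    (i : Fin 3) (hX : SmoothVField X) (hY : SmoothVField Y) (x : M) :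
    dirDeriv (S.ξ i) (S.fundForm i X Y) x =
      S.fundForm i (bracket (S.ξ i) X) Y x + S.fundForm i X (bracket (S.ξ i) Y) x := by
  have hξ := S.smooth_ξ i
  -- With `c = 0` the form θ is irrelevant; η_i merely fills the slot.
  have h := dirDeriv_dOne (c := 0) (S.smooth_η i) (S.smooth_η i) hξ
    (fun X hX x ↦ by rw [hS.dOne_ξ_self i hX, zero_mul]) hX hY x
  rw [hS.dirDeriv_dOne_eq i _ hX hY, dirDeriv_wedge hX hY, hS.2 _ _ (hξ.bracket hX) hY,
    hS.2 _ _ hX (hξ.bracket hY)] at h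
  simp only [dirDeriv_appForm_ξ, hS.dOne_ξ_one i hX, hS.dOne_ξ_one i hY, hS.dOne_ξ_two i hX,
    hS.dOne_ξ_two i hY, wedge, appForm] at h
  refine mul_left_cancel₀ (mul_ne_zero two_ne_zero hS.1) ?_
  linear_combination h

/-- In L_{ξ_i}dη_{i+1} = 2δ dη_{i+2} the wedge parts match by themselves, as L_{ξ_i}(η_{i+2} ∧ η_i)
= 2δ η_i ∧ η_{i+1}; the Φ-parts must then match too. -/
lemma IsThreeAlphaDeltaSasaki.dirDeriv_fundForm_one (hS : S.IsThreeAlphaDeltaSasaki α δ)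
    (i : Fin 3) (hX : SmoothVField X) (hY : SmoothVField Y) (x : M) :
    dirDeriv (S.ξ i) (S.fundForm (i + 1) X Y) x =
      S.fundForm (i + 1) (bracket (S.ξ i) X) Y x + S.fundForm (i + 1) X (bracket (S.ξ i) Y) x
        + 2 * δ * S.fundForm (i + 2) X Y x := by
  have hξ := S.smooth_ξ i
  have h := dirDeriv_dOne (S.smooth_η (i + 1)) (S.smooth_η (i + 2)) hξ
    (fun X hX ↦ hS.dOne_ξ_one i hX) hX hY x
  rw [hS.dirDeriv_dOne_eq _ _ hX hY, dirDeriv_wedge hX hY, hS.2 _ _ (hξ.bracket hX) hY,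
    hS.2 _ _ hX (hξ.bracket hY), hS.2 _ _ hX hY] at h
  simp only [fin_three_add_one_one, fin_three_add_one_two, fin_three_add_two_one,
    fin_three_add_two_two, dirDeriv_appForm_ξ, hS.dOne_ξ_self i hX, hS.dOne_ξ_self i hY,
    hS.dOne_ξ_two i hX, hS.dOne_ξ_two i hY, wedge, appForm] at h
  refine mul_left_cancel₀ (mul_ne_zero two_ne_zero hS.1) ?_
  linear_combination h

lemma IsThreeAlphaDeltaSasaki.dirDeriv_fundForm_two (hS : S.IsThreeAlphaDeltaSasaki α δ)
    (i : Fin 3) (hX : SmoothVField X) (hY : SmoothVField Y) (x : M) :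
    dirDeriv (S.ξ i) (S.fundForm (i + 2) X Y) x =
      S.fundForm (i + 2) (bracket (S.ξ i) X) Y x + S.fundForm (i + 2) X (bracket (S.ξ i) Y) x
        - 2 * δ * S.fundForm (i + 1) X Y x := by
  have hξ := S.smooth_ξ i
  have h := dirDeriv_dOne (S.smooth_η (i + 2)) (S.smooth_η (i + 1)) hξ
    (fun X hX ↦ hS.dOne_ξ_two i hX) hX hY x
  rw [hS.dirDeriv_dOne_eq _ _ hX hY, dirDeriv_wedge hX hY, hS.2 _ _ (hξ.bracket hX) hY,
    hS.2 _ _ hX (hξ.bracket hY), hS.2 _ _ hX hY] at h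
  simp only [fin_three_add_one_one, fin_three_add_one_two, fin_three_add_two_one,
    fin_three_add_two_two, dirDeriv_appForm_ξ, hS.dOne_ξ_self i hX, hS.dOne_ξ_self i hY,
    hS.dOne_ξ_one i hX, hS.dOne_ξ_one i hY, wedge, appForm] at h
  refine mul_left_cancel₀ (mul_ne_zero two_ne_zero hS.1) ?_
  linear_combination h

/-- Lie-differentiate Φ_{i+1}(W, φ_iY) = -Φ_{i+2}(W, Y) + η_{i+1}(W)η_i(Y) along ξ_i. The known
derivatives cancel by φ_{i+2}φ_i = φ_{i+1} + η_i ⊗ ξ_{i+2}, leaving g(W, φ_{i+1}(L_{ξ_i}φ_i)Y) = 0.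
Invariance of g is not needed. -/
lemma IsThreeAlphaDeltaSasaki.lieEnd_self (hS : S.IsThreeAlphaDeltaSasaki α δ) (i : Fin 3)
    (hY : SmoothVField Y) (x : M) : lieEnd (S.ξ i) (S.φ i) Y x = 0 := by
  have hξ := S.smooth_ξ i
  have hφY := S.smooth_appEnd i hY
  have hL : SmoothVField (lieEnd (S.ξ i) (S.φ i) Y) :=
    (hξ.bracket hφY).sub (S.smooth_appEnd i (hξ.bracket hY))
  -- The kernel of φ_{i+1} is spanned by ξ_{i+1}, so this component is treated separately, by
  -- differentiating η_{i+1}∘φ_i = -η_{i+2}.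
  have hη : S.η (i + 1) x (lieEnd (S.ξ i) (S.φ i) Y x) = 0 := by
    have h1 : appForm (S.η (i + 1)) (appEnd (S.φ i) Y) = fun y ↦ -appForm (S.η (i + 2)) Y y :=
      funext fun y ↦ S.η_φ_one_zero i y (Y y)
    have h2 := S.dirDeriv_appForm_ξ i (i + 1) (appEnd (S.φ i) Y) x
    rw [h1, dirDeriv_neg, dirDeriv_appForm_ξ, hS.dOne_ξ_two i hY, hS.dOne_ξ_one i hφY] at h2
    simp only [lieEnd, Pi.sub_apply, map_sub, appEnd, S.η_φ_one_zero, S.η_φ_two_zero] at h2 ⊢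
    linear_combination -h2
  refine S.eq_zero_of_φ_eq_zero (i + 1) x ?_ hη
  have key {W : VField (4 * n + 3) M} (hW : SmoothVField W) :
      inner ℝ (W x) (S.φ (i + 1) x (lieEnd (S.ξ i) (S.φ i) Y x)) = 0 := by
    have hp (V U : VField (4 * n + 3) M) (y : M) : S.fundForm (i + 1) V (appEnd (S.φ i) U) y =
        -S.fundForm (i + 2) V U y + S.η (i + 1) y (V y) * S.η i y (U y) := by
      simp only [fundForm, metric, appEnd, S.φ_φ_one_zero, inner_add_right, inner_neg_right,
        inner_smul_right]
      rw [real_inner_comm (S.ξ (i + 1) y), S.inner_ξ, mul_comm (S.η i y (U y))]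
    have h1 : S.fundForm (i + 1) W (appEnd (S.φ i) Y) = fun y ↦
        -S.fundForm (i + 2) W Y y + appForm (S.η (i + 1)) W y * appForm (S.η i) Y y :=
      funext (hp W Y)
    have hΦ := S.smooth_fundForm (i + 2) hW hY
    have hηW := S.smooth_appForm (i + 1) hW
    have hηY := S.smooth_appForm i hY
    have h2 := hS.dirDeriv_fundForm_one i hW hφY x
    rw [h1, dirDeriv_add _ hΦ.neg (hηW.mul hηY), dirDeriv_neg, dirDeriv_mul _ hηW hηY,
      hS.dirDeriv_fundForm_two i hW hY, dirDeriv_appForm_ξ, dirDeriv_appForm_ξ,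
      hS.dOne_ξ_one i hW, hS.dOne_ξ_self i hY, hp] at h2
    have h3 := hp W (bracket (S.ξ i) Y) x
    simp only [fundForm, metric, appEnd, appForm, lieEnd, Pi.sub_apply, map_sub,
      inner_sub_right, S.φ_φ_two_zero, inner_add_right, inner_smul_right] at h2 h3 ⊢
    rw [real_inner_comm (S.ξ (i + 2) x), S.inner_ξ] at h2
    linear_combination -h2 - h3
  exact inner_self_eq_zero.1 (key (S.smooth_appEnd (i + 1) hL))

/-- The metric is η_i ⊗ η_i - Φ_i(·, φ_i·), and all three ingredients are ξ_i-invariant. -/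
lemma IsThreeAlphaDeltaSasaki.isKilling (hS : S.IsThreeAlphaDeltaSasaki α δ) (i : Fin 3) :
    IsKilling (S.ξ i) := by
  refine ⟨S.smooth_ξ i, fun X Y hX hY x ↦ ?_⟩
  have hφY := S.smooth_appEnd i hY
  have hp (V U : VField (4 * n + 3) M) (y : M) : metric V U y =
      S.η i y (V y) * S.η i y (U y) - S.fundForm i V (appEnd (S.φ i) U) y := by
    simp only [fundForm, metric, appEnd, S.φ_sq, inner_add_right, inner_neg_right,
      inner_smul_right]
    rw [real_inner_comm (S.ξ i y), S.inner_ξ]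
    ring
  have h1 : metric X Y = fun y ↦ appForm (S.η i) X y * appForm (S.η i) Y y
      - S.fundForm i X (appEnd (S.φ i) Y) y := funext (hp X Y)
  have hηX := S.smooth_appForm i hX
  have hηY := S.smooth_appForm i hY
  have h2 := hS.lieEnd_self i hY x
  rw [lieEnd, Pi.sub_apply, sub_eq_zero] at h2
  rw [lieMetric, hp, hp, h1, dirDeriv_sub _ (hηX.mul hηY) (S.smooth_fundForm i hX hφY),
    dirDeriv_mul _ hηX hηY, hS.dirDeriv_fundForm_self i hX hφY, dirDeriv_appForm_ξ,
    dirDeriv_appForm_ξ, hS.dOne_ξ_self i hX, hS.dOne_ξ_self i hY]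
  simp only [fundForm, metric, appForm, h2, appEnd]
  ring

/-- Once ξ_i is Killing, L_{ξ_i} passes through g, so derivatives of Φ_l become derivatives of φ_l.
-/
lemma IsThreeAlphaDeltaSasaki.inner_lieEnd (hS : S.IsThreeAlphaDeltaSasaki α δ) (i l : Fin 3)
    (hX : SmoothVField X) (hY : SmoothVField Y) (x : M) :
    inner ℝ (X x) (lieEnd (S.ξ i) (S.φ l) Y x) = dirDeriv (S.ξ i) (S.fundForm l X Y) x
      - S.fundForm l (bracket (S.ξ i) X) Y x - S.fundForm l X (bracket (S.ξ i) Y) x := by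
  have h := (hS.isKilling i).2 X (appEnd (S.φ l) Y) hX (S.smooth_appEnd l hY) x
  simp only [lieMetric, fundForm, lieEnd, Pi.sub_apply, metric, appEnd, inner_sub_right] at h ⊢
  linear_combination -h

lemma IsThreeAlphaDeltaSasaki.lieEnd_one (hS : S.IsThreeAlphaDeltaSasaki α δ) (i : Fin 3)
    (hY : SmoothVField Y) (x : M) :
    lieEnd (S.ξ i) (S.φ (i + 1)) Y x = (2 * δ) • S.φ (i + 2) x (Y x) := by
  refine ext_inner_left ℝ fun v ↦ ?_
  obtain ⟨X, hX, rfl⟩ := exists_smoothVField_eq x v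
  rw [hS.inner_lieEnd i _ hX hY, hS.dirDeriv_fundForm_one i hX hY, inner_smul_right]
  simp only [fundForm, metric, appEnd]
  ring

lemma IsThreeAlphaDeltaSasaki.lieEnd_two (hS : S.IsThreeAlphaDeltaSasaki α δ) (i : Fin 3)
    (hY : SmoothVField Y) (x : M) :
    lieEnd (S.ξ i) (S.φ (i + 2)) Y x = -((2 * δ) • S.φ (i + 1) x (Y x)) := by
  refine ext_inner_left ℝ fun v ↦ ?_
  obtain ⟨X, hX, rfl⟩ := exists_smoothVField_eq x v
  rw [hS.inner_lieEnd i _ hX hY, hS.dirDeriv_fundForm_two i hX hY, inner_neg_right,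
    inner_smul_right]
  simp only [fundForm, metric, appEnd]
  ring

lemma IsThreeAlphaDeltaSasaki.lieEnd_one_zero (hS : S.IsThreeAlphaDeltaSasaki α δ) (i : Fin 3)
    (hY : SmoothVField Y) (x : M) :
    lieEnd (S.ξ (i + 1)) (S.φ i) Y x = -((2 * δ) • S.φ (i + 2) x (Y x)) := by
  have h := hS.lieEnd_two (i + 1) hY x
  rwa [fin_three_add_one_two, fin_three_add_one_one] at h

/-! ### Reeb Killing function and Levi-Civita derivative. -/

/-- In A_{i,i+1} the Lie derivative contributes 2δΦ_{i+2} and each of the two dη-terms -2αΦ_{i+2}.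
In A_{ii} the dη-terms cancel. -/
lemma IsThreeAlphaDeltaSasaki.isReebKillingFunction (hS : S.IsThreeAlphaDeltaSasaki α δ) :
    S.IsReebKillingFunction (fun _ ↦ 2 * (δ - 2 * α)) := by
  refine ⟨SmoothFun.const _, fun X Y hX hY i x ↦ ?_⟩
  have hφX (l : Fin 3) := hX.appEnd l
  have hφY (l : Fin 3) := hY.appEnd l
  have hd (l : Fin 3) {U V : VField (4 * n + 3) M} (hU : S.Horizontal U) (hV : S.Horizontal V) :
      dOne (S.η l) U V x = 2 * α * S.fundForm l U V x := by
    rw [hS.2 U V hU.1 hV.1]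
    simp [wedge, appForm, hU.2]
  simp only [A, hd _ hX (hφY _), hd _ (hφX _) hY, metric, hS.lieEnd_self i hX.1,
    hS.lieEnd_one i hX.1, hS.lieEnd_one_zero i hX.1]
  simp only [fundForm, metric, appEnd, S.φ_sq, S.φ_φ_one_zero, S.φ_φ_zero_one, S.inner_φ_left,
    hY.2, zero_smul, add_zero, inner_zero_left, inner_neg_left, inner_neg_right,
    inner_smul_left]
  refine ⟨by ring, ?_, ?_⟩ <;> simp <;> ring

lemma IsThreeAlphaDeltaSasaki.leviCivita_ξ (hS : S.IsThreeAlphaDeltaSasaki α δ)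
    {D : CovariantDerivative (𝓡 (4 * n + 3)) (EuclideanSpace ℝ (Fin (4 * n + 3)))
        (fun x : M ↦ TangentSpace (𝓡 (4 * n + 3)) x)} (hD : IsLeviCivita D)
    (i : Fin 3) (x : M) (v : TangentSpace (𝓡 (4 * n + 3)) x) :
    D (S.ξ i) x v = -(α • S.φ i x v)
      - (α - δ) • (S.η (i + 2) x v • S.ξ (i + 1) x - S.η (i + 1) x v • S.ξ (i + 2) x) := by
  refine ext_inner_right ℝ fun w ↦ ?_
  obtain ⟨X, hX, rfl⟩ := exists_smoothVField_eq x v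
  obtain ⟨Y, hY, rfl⟩ := exists_smoothVField_eq x w
  have h := hD.two_mul_inner_killing (hS.isKilling i) (S.inner_ξ i) hX hY x
  rw [hS.2 X Y hX hY] at h
  simp only [fundForm, metric, appEnd, wedge, appForm] at h
  simp only [inner_sub_left, inner_neg_left, inner_smul_left, S.inner_ξ, S.inner_φ_left]
  simp only [conj_trivial]
  linear_combination h / 2

/-! ### Closedness and integrability on H. -/

lemma IsThreeAlphaDeltaSasaki.dTwo_fundForm_horizontal (hS : S.IsThreeAlphaDeltaSasaki α δ)
    (l : Fin 3) (hX : S.Horizontal X) (hY : S.Horizontal Y) (hZ : S.Horizontal Z) (x : M) :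
    dTwo (S.fundForm l) X Y Z x = 0 := by
  -- One horizontal argument already kills the wedge term. This matters because brackets of
  -- horizontal fields need not be horizontal.
  have hb {U V : VField (4 * n + 3) M} (hU : SmoothVField U) (hV : S.Horizontal V) (y : M) :
      dOne (S.η l) U V y = 2 * α * S.fundForm l U V y := by
    rw [hS.2 U V hU hV.1]
    simp [wedge, appForm, hV.2]
  have hf {U V : VField (4 * n + 3) M} (hU : SmoothVField U) (hV : S.Horizontal V) :
      dOne (S.η l) U V = fun y ↦ 2 * α * S.fundForm l U V y := funext (hb hU hV)
  have h := dTwo_dOne (S.smooth_η l) hX.1 hY.1 hZ.1 x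
  rw [dTwo, hf hX.1 hY, hf hY.1 hZ, hf hZ.1 hX,
    dirDeriv_const_mul _ _ (S.smooth_fundForm l hX.1 hY.1),
    dirDeriv_const_mul _ _ (S.smooth_fundForm l hY.1 hZ.1),
    dirDeriv_const_mul _ _ (S.smooth_fundForm l hZ.1 hX.1),
    hb (hX.1.bracket hY.1) hZ, hb (hY.1.bracket hZ.1) hX, hb (hZ.1.bracket hX.1) hY] at h
  refine mul_left_cancel₀ (mul_ne_zero two_ne_zero hS.1) ?_
  rw [dTwo]
  linear_combination h

/-- Write J = φ_i. On H the form ω = Φ_{i+1} + √-1 Φ_{i+2} has type (2,0) for J. Evaluating dω = 0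
on (X + √-1 JX, Y + √-1 JY, Z), the derivative terms vanish and the real part of the bracket terms
is the pairing with N. -/
lemma IsThreeAlphaDeltaSasaki.inner_N_horizontal (hS : S.IsThreeAlphaDeltaSasaki α δ)
    (i : Fin 3) (hX : S.Horizontal X) (hY : S.Horizontal Y) (hZ : S.Horizontal Z) (x : M) :
    inner ℝ (S.N i X Y x) (S.φ (i + 1) x (Z x)) = 0 := by
  have hJX := hX.appEnd i
  have hJY := hY.appEnd i
  -- `a1`–`a4` express the type of ω. Only V is horizontal, so U may be a bracket.
  have a1 (U : VField (4 * n + 3) M) {V : VField (4 * n + 3) M} (hV : S.Horizontal V) :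
      S.fundForm (i + 1) U (appEnd (S.φ i) V) = fun y ↦ -S.fundForm (i + 2) U V y := by
    funext y
    simp [fundForm, metric, appEnd, S.φ_φ_one_zero, hV.2]
  have a2 (U : VField (4 * n + 3) M) {V : VField (4 * n + 3) M} (hV : S.Horizontal V) :
      S.fundForm (i + 2) U (appEnd (S.φ i) V) = S.fundForm (i + 1) U V := by
    funext y
    simp [fundForm, metric, appEnd, S.φ_φ_two_zero, hV.2]
  have a3 (U : VField (4 * n + 3) M) {V : VField (4 * n + 3) M} (hV : S.Horizontal V) :
      S.fundForm (i + 1) (appEnd (S.φ i) U) V = fun y ↦ -S.fundForm (i + 2) U V y := by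
    funext y
    simp [fundForm, metric, appEnd, S.inner_φ_left, S.φ_φ_zero_one, hV.2]
  have a4 (U : VField (4 * n + 3) M) {V : VField (4 * n + 3) M} (hV : S.Horizontal V) :
      S.fundForm (i + 2) (appEnd (S.φ i) U) V = S.fundForm (i + 1) U V := by
    funext y
    simp [fundForm, metric, appEnd, S.inner_φ_left, S.φ_φ_zero_two, hV.2]
  have h1 := hS.dTwo_fundForm_horizontal (i + 1) hX hY hZ x
  have h2 := hS.dTwo_fundForm_horizontal (i + 1) hJX hJY hZ x
  have h3 := hS.dTwo_fundForm_horizontal (i + 2) hJX hY hZ x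
  have h4 := hS.dTwo_fundForm_horizontal (i + 2) hX hJY hZ x
  simp only [dTwo, a3 X hJY, a2 X hY, a3 Y hZ, a1 Z hX] at h2
  simp only [dTwo, a4 X hY, a2 Z hX, a2 _ hX] at h3
  simp only [dTwo, a2 X hY, a4 Y hZ, a2 _ hY] at h4
  simp only [dTwo] at h1
  rw [a1 _ hX, a1 _ hY] at h2
  simp only [dirDeriv_neg] at h2
  simp only [N, nijenhuis, inner_add_left, inner_sub_left, inner_smul_left, S.φ_sq,
    inner_neg_left, S.inner_φ_left i, S.φ_φ_zero_one, hZ.2, zero_smul, add_zero, S.inner_ξ,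
    S.η_φ_zero_one, mul_zero]
  simp only [fundForm, metric, appEnd] at h1 h2 h3 h4 ⊢
  -- These signs are those of the real part of dω(X + √-1 JX, Y + √-1 JY, Z).
  linear_combination h1 - h2 - h3 - h4

lemma IsThreeAlphaDeltaSasaki.N₃_horizontal (hS : S.IsThreeAlphaDeltaSasaki α δ)
    (i : Fin 3) (hX : S.Horizontal X) (hY : S.Horizontal Y) (hZ : S.Horizontal Z) (x : M) :
    S.N₃ i X Y Z x = 0 := by
  -- Since φ_{i+1}² = -1 on H, testing against φ_{i+1}Z reaches every horizontal Z.
  have h := hS.inner_N_horizontal i hX hY (hZ.appEnd (i + 1)) x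
  rwa [appEnd, S.φ_sq, hZ.2, zero_smul, add_zero, inner_neg_right, neg_eq_zero] at h

lemma IsThreeAlphaDeltaSasaki.isCanonical (hS : S.IsThreeAlphaDeltaSasaki α δ) :
    S.IsCanonical where
  skew i X Y Z hX hY hZ x := by
    rw [hS.N₃_horizontal i hX hY hZ, hS.N₃_horizontal i hY hX hZ, hS.N₃_horizontal i hX hZ hY]
    simp
  killing := hS.isKilling
  twist X Y Z hX hY hZ i j x := by
    rw [hS.N₃_horizontal i hX hY hZ, hS.N₃_horizontal j hX hY hZ,
      hS.dTwo_fundForm_horizontal i (hX.appEnd i) (hY.appEnd i) (hZ.appEnd i),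
      hS.dTwo_fundForm_horizontal j (hX.appEnd j) (hY.appEnd j) (hZ.appEnd j)]
  reebKilling := ⟨_, hS.isReebKillingFunction⟩

end Sasaki

end AlmostThreeContactMetric

end ThreeContact

theorem mainTheorem8 {n : ℕ} {M : Type*} [TopologicalSpace M] [T2Space M]
    [ChartedSpace (EuclideanSpace ℝ (Fin (4 * n + 3))) M]
    [IsManifold (𝓡 (4 * n + 3)) ∞ M]
    [RiemannianBundle (fun x : M ↦ TangentSpace (𝓡 (4 * n + 3)) x)]
    [IsContMDiffRiemannianBundle (𝓡 (4 * n + 3)) ∞ (EuclideanSpace ℝ (Fin (4 * n + 3)))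
      (fun x : M ↦ TangentSpace (𝓡 (4 * n + 3)) x)]
    (S : ThreeContact.AlmostThreeContactMetric n M) (α δ : ℝ) (hS : S.IsThreeAlphaDeltaSasaki α δ) :
    S.IsCanonical ∧
    S.IsReebKillingFunction (fun _ ↦ 2 * (δ - 2 * α)) ∧
    S.IsReebCommutatorFunction (fun _ ↦ δ) ∧
    (∀ D : CovariantDerivative (𝓡 (4 * n + 3)) (EuclideanSpace ℝ (Fin (4 * n + 3)))
        (fun x : M ↦ TangentSpace (𝓡 (4 * n + 3)) x), ThreeContact.IsLeviCivita D →
      ∀ i x (v : TangentSpace (𝓡 (4 * n + 3)) x),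
        D (S.ξ i) x v = -(α • S.φ i x v)
          - (α - δ) • (S.η (i + 2) x v • S.ξ (i + 1) x - S.η (i + 1) x v • S.ξ (i + 2) x)) ∧
    (∀ X : ThreeContact.VField (4 * n + 3) M, ThreeContact.SmoothVField X → ∀ i x,
      ThreeContact.lieEnd (S.ξ i) (S.φ i) X x = 0 ∧
      ThreeContact.lieEnd (S.ξ i) (S.φ (i + 1)) X x = (2 * δ) • S.φ (i + 2) x (X x) ∧
      ThreeContact.lieEnd (S.ξ (i + 1)) (S.φ i) X x = -((2 * δ) • S.φ (i + 2) x (X x))) := by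
  exact ⟨hS.isCanonical, hS.isReebKillingFunction, hS.isReebCommutatorFunction,
    fun _ hD ↦ hS.leviCivita_ξ hD,
    fun _ hX i x ↦ ⟨hS.lieEnd_self i hX x, hS.lieEnd_one i hX x, hS.lieEnd_one_zero i hX x⟩⟩
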